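/- Let $H$ be a nonzero complex Hilbert space. For $n\ge 0$ let $H^{\otimes n}$ be the $n$-fold Hilbert tensor product of $H$ (with $H^{\otimes 0}=\mathbb C$), and let $H^{\odot n}$ be the closed linear span in $H^{\otimes n}$ of the symmetric tensors $\sum_{\sigma\in S_n} h_{\sigma(1)}\otimes\cdots\otimes h_{\sigma(n)}$, $h_1,\dots,h_n\in H$ (with $H^{\odot 0}=\mathbb C$). Let $\Gamma(H)=\bigoplus_{n\ge 0}H^{\otimes n}$ and $\Gamma^{\odot}(H)=\bigoplus_{n\ge 0}H^{\odot n}$ (Hilbert space direct sums) be the Fock space and the symmetric Fock space over $H$. For a bounded linear operator $T$ on $H$ with $\|T\|\le 1$ let $T^{\otimes n}$ be the bounded operator on $H^{\otimes n}$ with $T^{\otimes n}(h_1\otimes\cdots\otimes h_n)=Th_1\otimes\cdots\otimes Th_n$ (with $T^{\otimes 0}=I$), let $T^{\odot n}$ be its restriction to the invariant subspace $H^{\odot n}$, and let $\Gamma(T)=\bigoplus_{n\ge 0}T^{\otimes n}$ and $\Gamma^{\odot}(T)=\bigoplus_{n\ge 0}T^{\odot n}$ be the second quantization and the symmetric second quantization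 of $T$. Denote the spectrum by $\sigma$. If $T$ is a compact linear operator on $H$ with $\|T\|<1$, then $$\sigma(\Gamma^{\odot}(T))=\sigma(\Gamma(T))=\{0\}\cup\{1\}\cup\bigcup_{n\ge 1}\Bigl\{\prod_{j=1}^n\lambda_j:\ \lambda_j\in\sigma(T);\ j=1,\dots,n\Bigr\}.$$ -/

import Mathlib

universe u

open scoped TensorProduct ENNReal

noncomputable section

/-- The one-dimensional complex Hilbert space `ℂ`, in an arbitrary universe, with its usual
inner product `⟪x, y⟫ = conj x * y`. -/
instance ULift.complexInnerProductSpace : InnerProductSpace ℂ (ULift.{u} ℂ) where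
  inner x y := inner ℂ x.down y.down
  norm_sq_eq_re_inner x := norm_sq_eq_re_inner x.down
  conj_inner_symm x y := inner_conj_symm x.down y.down
  add_left x y z := inner_add_left x.down y.down z.down
  smul_left x y r := inner_smul_left x.down y.down r

/-- Complex Hilbert spaces, bundled; used only to define tensor powers by recursion. -/
structure BundledHilbert : Type (u + 1) where
  /-- the underlying type -/
  carrier : Type u
  [normed : NormedAddCommGroup carrier]
  [innerProduct : InnerProductSpace ℂ carrier]
  [complete : CompleteSpace carrier]

attribute [instance] BundledHilbert.normed BundledHilbert.innerProduct BundledHilbert.complete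

/-- The Hilbert tensor product of two inner product spaces: the completion of the algebraic tensor
product for the inner product `⟪a ⊗ b, c ⊗ d⟫ = ⟪a, c⟫ * ⟪b, d⟫`. -/
abbrev HilbertTensor (E F : Type u) [NormedAddCommGroup E] [InnerProductSpace ℂ E]
    [NormedAddCommGroup F] [InnerProductSpace ℂ F] : Type u :=
  UniformSpace.Completion (E ⊗[ℂ] F)

/-- The operator `S ⊗ T` on Hilbert tensor products, the continuous extension of
`x ⊗ y ↦ S x ⊗ T y`. -/
def hilbertTensorMap {E F E' F' : Type u} [NormedAddCommGroup E] [InnerProductSpace ℂ E]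
    [NormedAddCommGroup F] [InnerProductSpace ℂ F] [NormedAddCommGroup E'] [InnerProductSpace ℂ E']
    [NormedAddCommGroup F'] [InnerProductSpace ℂ F'] (S : E →L[ℂ] E') (T : F →L[ℂ] F') :
    HilbertTensor E F →L[ℂ] HilbertTensor E' F' :=
  (TensorProduct.mapL S T).completion

theorem norm_hilbertTensorMap_le {E F E' F' : Type u} [NormedAddCommGroup E]
    [InnerProductSpace ℂ E] [NormedAddCommGroup F] [InnerProductSpace ℂ F] [NormedAddCommGroup E']
    [InnerProductSpace ℂ E'] [NormedAddCommGroup F'] [InnerProductSpace ℂ F']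
    (S : E →L[ℂ] E') (T : F →L[ℂ] F') : ‖hilbertTensorMap S T‖ ≤ ‖S‖ * ‖T‖ := by
  refine ContinuousLinearMap.opNorm_le_bound _ (by positivity) fun x => ?_
  induction x using UniformSpace.Completion.induction_on with
  | hp => exact isClosed_le (by fun_prop) (by fun_prop)
  | ih x =>
    rw [hilbertTensorMap, ContinuousLinearMap.completion_apply_coe,
      UniformSpace.Completion.norm_coe, UniformSpace.Completion.norm_coe]
    exact (TensorProduct.mapL S T).le_of_opNorm_le (TensorProduct.norm_mapL_le S T) x

section

variable (H : Type u) [NormedAddCommGroup H] [InnerProductSpace ℂ H]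

/-- `H^{⊗0} = ℂ` and `H^{⊗(n+1)}` is the Hilbert tensor product of `H^{⊗n}` and `H`. -/
def tensorPowerBundled : ℕ → BundledHilbert.{u}
  | 0 => ⟨ULift.{u} ℂ⟩
  | n + 1 => ⟨HilbertTensor (tensorPowerBundled n).carrier H⟩

/-- The `n`-fold Hilbert tensor power `H^{⊗n}`. -/
abbrev HilbertTensorPower (n : ℕ) : Type u := (tensorPowerBundled H n).carrier

variable {H}

/-- The elementary tensor `h 0 ⊗ ⋯ ⊗ h (n - 1)` in `H^{⊗n}`. -/
def elementaryTensor : (n : ℕ) → (Fin n → H) → HilbertTensorPower H n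
  | 0, _ => (ULift.up 1 : ULift.{u} ℂ)
  | n + 1, h =>
    ((elementaryTensor n (fun i => h i.castSucc) ⊗ₜ[ℂ] h (Fin.last n) :
      HilbertTensorPower H n ⊗[ℂ] H) : HilbertTensor (HilbertTensorPower H n) H)

/-- The operator `T^{⊗n}` on `H^{⊗n}`, with `T^{⊗0} = I`. -/
def tensorPowerMap (T : H →L[ℂ] H) : (n : ℕ) → HilbertTensorPower H n →L[ℂ] HilbertTensorPower H n
  | 0 => ContinuousLinearMap.id ℂ (ULift.{u} ℂ)
  | n + 1 => hilbertTensorMap (tensorPowerMap T n) T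

theorem tensorPowerMap_elementaryTensor (T : H →L[ℂ] H) (n : ℕ) (h : Fin n → H) :
    tensorPowerMap T n (elementaryTensor n h) = elementaryTensor n (fun i => T (h i)) := by
  induction n with
  | zero => rfl
  | succ n ih =>
    refine (ContinuousLinearMap.completion_apply_coe (TensorProduct.mapL (tensorPowerMap T n) T)
      (elementaryTensor n (fun i => h i.castSucc) ⊗ₜ[ℂ] h (Fin.last n))).trans ?_
    rw [TensorProduct.mapL_tmul, ih]
    rfl

theorem norm_tensorPowerMap_le_one (T : H →L[ℂ] H) (hT : ‖T‖ ≤ 1) (n : ℕ) :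
    ‖tensorPowerMap T n‖ ≤ 1 := by
  induction n with
  | zero => exact ContinuousLinearMap.norm_id_le
  | succ n ih =>
    exact (norm_hilbertTensorMap_le (tensorPowerMap T n) T).trans
      (mul_le_one₀ ih (norm_nonneg _) hT)

/-- The elementary symmetric tensor `∑_σ h (σ 0) ⊗ ⋯ ⊗ h (σ (n - 1))`, the sum being over all
permutations `σ`. -/
def symmetricTensor (n : ℕ) (h : Fin n → H) : HilbertTensorPower H n :=
  ∑ σ : Equiv.Perm (Fin n), elementaryTensor n (fun i => h (σ i))

variable (H) in
/-- The `n`-fold symmetric tensor power `H^{⊙n}`: the closed linear span in `H^{⊗n}` of the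
elementary symmetric tensors. For `n = 0` this is all of `H^{⊗0} = ℂ`. -/
def symmetricPower (n : ℕ) : Submodule ℂ (HilbertTensorPower H n) :=
  (Submodule.span ℂ (Set.range (symmetricTensor (H := H) n))).topologicalClosure

theorem tensorPowerMap_mem_symmetricPower (T : H →L[ℂ] H) (n : ℕ) :
    ∀ x ∈ symmetricPower H n, tensorPowerMap T n x ∈ symmetricPower H n := by
  have hspan : ∀ x ∈ Submodule.span ℂ (Set.range (symmetricTensor (H := H) n)),
      tensorPowerMap T n x ∈ Submodule.span ℂ (Set.range (symmetricTensor (H := H) n)) := by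
    intro x hx
    induction hx using Submodule.span_induction with
    | mem x hx =>
      obtain ⟨h, rfl⟩ := hx
      refine Submodule.subset_span ⟨fun i => T (h i), ?_⟩
      simp only [symmetricTensor, map_sum, tensorPowerMap_elementaryTensor]
    | zero => simp
    | add x y _ _ hx hy => rw [map_add]; exact add_mem hx hy
    | smul c x _ hx => rw [map_smul]; exact Submodule.smul_mem _ c hx
  intro x hx
  exact map_mem_closure (tensorPowerMap T n).continuous hx hspan

/-- The operator `T^{⊙n}`: the restriction of `T^{⊗n}` to `H^{⊙n}`. -/
def symmetricPowerMap (T : H →L[ℂ] H) (n : ℕ) : symmetricPower H n →L[ℂ] symmetricPower H n :=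
  (tensorPowerMap T n).restrict (tensorPowerMap_mem_symmetricPower T n)

theorem norm_symmetricPowerMap_le_one (T : H →L[ℂ] H) (hT : ‖T‖ ≤ 1) (n : ℕ) :
    ‖symmetricPowerMap T n‖ ≤ 1 :=
  ContinuousLinearMap.opNorm_le_bound _ zero_le_one fun x =>
    (tensorPowerMap T n).le_of_opNorm_le (norm_tensorPowerMap_le_one T hT n) x

variable (H) in
/-- The Fock space `Γ(H)`, the Hilbert space direct sum of the `H^{⊗n}`, `n ≥ 0`. -/
abbrev FockSpace : Type u := lp (fun n : ℕ => HilbertTensorPower H n) 2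

variable (H) in
/-- The symmetric Fock space `Γ^⊙(H)`, the Hilbert space direct sum of the `H^{⊙n}`, `n ≥ 0`. -/
abbrev SymmetricFockSpace : Type u := lp (fun n : ℕ => symmetricPower H n) 2

/-- The second quantization `Γ(T) = ⨁ T^{⊗n}` of a contraction `T`. -/
def secondQuantization (T : H →L[ℂ] H) (hT : ‖T‖ ≤ 1) : FockSpace H →L[ℂ] FockSpace H :=
  lp.mapCLM 2 (tensorPowerMap T) zero_le_one (norm_tensorPowerMap_le_one T hT)

/-- The symmetric second quantization `Γ^⊙(T) = ⨁ T^{⊙n}` of a contraction `T`. -/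
def symmetricSecondQuantization (T : H →L[ℂ] H) (hT : ‖T‖ ≤ 1) :
    SymmetricFockSpace H →L[ℂ] SymmetricFockSpace H :=
  lp.mapCLM 2 (symmetricPowerMap T) zero_le_one (norm_symmetricPowerMap_le_one T hT)

end

end

/-!
Write `T^{⊗n}` for the tensor powers of the compact operator `T`. Each `T^{⊗n}` is compact: on
Hilbert spaces compact operators are norm limits of finite rank operators
(`IsCompactOperator.exists_norm_sub_starProjection_comp_le`), and this passes to tensor products
(`isCompactOperator_bundledTensorMap`). Since `‖T^{⊗n}‖ ≤ ‖T‖ ^ n → 0`, the direct sums `Γ(T)` and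
`Γ^⊙(T)` are norm limits of finite partial sums, so they are compact as well
(`lp.isCompactOperator_mapCLM`). By the Fredholm alternative their nonzero spectrum consists of
eigenvalues, and by looking at one nonzero component of an eigenvector these are exactly the
eigenvalues of the summands (`lp.mem_spectrum_mapCLM_iff`). It remains to treat one degree `n`.

* An eigenvalue `z ≠ 0` of a compact `A ⊗ B` is a product `a * b` with `a ∈ σ(A)`, `b ∈ σ(B)`
  (`exists_mem_spectrum_mul_eq_of_hasEigenvalue`): its eigenspace is finite-dimensional and
  invariant under `A ⊗ 1`, so it contains an eigenvector of `A ⊗ 1`, with eigenvalue `a`, which is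
  then an eigenvector of `1 ⊗ B` with eigenvalue `z / a`; and the unital homomorphisms `A ↦ A ⊗ 1`,
  `B ↦ 1 ⊗ B` do not enlarge spectra. By induction the nonzero eigenvalues of `T^{⊗n}`, hence of
  its restriction `T^{⊙n}`, are `n`-fold products from `σ(T)`.
* Conversely, if `T h_j = λ_j h_j` then the symmetric tensor of the `h_j` satisfies the eigenvector
  equation of `T^{⊙n}` for `∏ λ_j`. It is nonzero (`symmetricTensor_ne_zero`): choosing `v`
  orthogonal to none of the `h_j`, its inner product with `v ⊗ ⋯ ⊗ v` is `n! ∏ ⟪v, h_j⟫`.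

The point `1` is the empty product, coming from degree `0`. The point `0` is in both spectra since
all summands are nonzero and the norms of the `T^{⊗n}` tend to `0`, so that neither sum is bounded
below.
-/

noncomputable section

open Filter Topology Module

/-! ### Finite rank approximation of compact operators -/

section FiniteRank

theorem ContinuousLinearMap.isCompactOperator_of_forall_mem {E F : Type*} [NormedAddCommGroup E]
    [NormedSpace ℂ E] [NormedAddCommGroup F] [NormedSpace ℂ F] (A : E →L[ℂ] F)
    (W : Submodule ℂ F) [FiniteDimensional ℂ W] (hA : ∀ x, A x ∈ W) : IsCompactOperator A := by
  have : ProperSpace W := FiniteDimensional.proper ℂ W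
  exact (isCompactOperator_of_locallyCompactSpace_rng W.subtypeL).comp_clm (A.codRestrict W hA)

theorem isCompactOperator_of_forall_exists_norm_sub_lt {E F : Type*} [NormedAddCommGroup E]
    [NormedSpace ℂ E] [NormedAddCommGroup F] [NormedSpace ℂ F] [CompleteSpace F] {A : E →L[ℂ] F}
    (h : ∀ ε > 0, ∃ B : E →L[ℂ] F, IsCompactOperator B ∧ ‖A - B‖ < ε) : IsCompactOperator A := by
  have hA : A ∈ closure {B : E →L[ℂ] F | IsCompactOperator B} :=
    Metric.mem_closure_iff.2 fun ε hε => by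
      simpa only [dist_eq_norm, Set.mem_ofPred_eq] using h ε hε
  exact isClosed_setOfPred_isCompactOperator.closure_subset hA

/-- A compact operator into a Hilbert space is approximated in norm by its compression to the span
of a finite `ε`-net of the image of the unit ball. -/
theorem IsCompactOperator.exists_norm_sub_starProjection_comp_le {E F : Type*}
    [NormedAddCommGroup E] [NormedSpace ℂ E] [NormedAddCommGroup F] [InnerProductSpace ℂ F]
    {A : E →L[ℂ] F} (hA : IsCompactOperator A) {ε : ℝ} (hε : 0 < ε) :
    ∃ U : Submodule ℂ F, ∃ _ : FiniteDimensional ℂ U, ‖A - U.starProjection ∘L A‖ ≤ ε := by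
  obtain ⟨K, hK, hAK⟩ := hA.image_closedBall_subset_compact 1
  obtain ⟨t, -, ht, hcover⟩ := hK.finite_cover_balls hε
  have hfin : FiniteDimensional ℂ (Submodule.span ℂ t) := FiniteDimensional.span_of_finite ℂ ht
  refine ⟨Submodule.span ℂ t, hfin,
    ContinuousLinearMap.opNorm_le_of_unit_norm hε.le fun x hx => ?_⟩
  obtain ⟨y, hy, hxy⟩ := Set.mem_iUnion₂.1 (hcover (hAK ⟨x, by simp [hx], rfl⟩))
  rw [Metric.mem_ball, dist_eq_norm] at hxy
  have hmin := Submodule.starProjection_minimal (U := Submodule.span ℂ t) (A x)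
  -- The projection is the nearest point in the span, hence at least as close as the net point `y`.
  calc ‖(A - (Submodule.span ℂ t).starProjection ∘L A) x‖
      = ⨅ w : Submodule.span ℂ t, ‖A x - w‖ := by simpa using hmin
    _ ≤ ‖A x - y‖ :=
      ciInf_le ⟨0, by rintro _ ⟨w, rfl⟩; positivity⟩
        (⟨y, Submodule.subset_span hy⟩ : Submodule.span ℂ t)
    _ ≤ ε := hxy.le

end FiniteRank

/-! ### Tensor products of operators -/

section HilbertTensor

variable {E F E' F' E'' F'' : Type u}
  [NormedAddCommGroup E] [InnerProductSpace ℂ E] [NormedAddCommGroup F] [InnerProductSpace ℂ F]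
  [NormedAddCommGroup E'] [InnerProductSpace ℂ E'] [NormedAddCommGroup F'] [InnerProductSpace ℂ F']
  [NormedAddCommGroup E''] [InnerProductSpace ℂ E'']
  [NormedAddCommGroup F''] [InnerProductSpace ℂ F'']

variable (E F) in
/-- The Hilbert tensor product as a bundled Hilbert space. Unlike `HilbertTensor`, this is not
unfolded by instance search, so that its normed structure does not compete with the algebraic
structures on a completion. -/
def bundledHilbertTensor : BundledHilbert.{u} := ⟨HilbertTensor E F⟩

variable (E F) in
/-- The underlying type of the bundled Hilbert tensor product. -/
abbrev BundledTensor : Type u := (bundledHilbertTensor E F).carrier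

variable (E F) in
/-- The isometric embedding of the algebraic tensor product into the Hilbert tensor product. -/
def bundledTensorIncl : E ⊗[ℂ] F →L[ℂ] BundledTensor E F :=
  (UniformSpace.Completion.toComplL : E ⊗[ℂ] F →L[ℂ] HilbertTensor E F)

/-- The operator `A ⊗ B`, between bundled Hilbert tensor products. -/
def bundledTensorMap (A : E →L[ℂ] E') (B : F →L[ℂ] F') :
    BundledTensor E F →L[ℂ] BundledTensor E' F' :=
  hilbertTensorMap A B

theorem denseRange_bundledTensorIncl : DenseRange (bundledTensorIncl E F) :=
  UniformSpace.Completion.denseRange_coe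

theorem inner_bundledTensorIncl (x y : E ⊗[ℂ] F) :
    inner ℂ (bundledTensorIncl E F x) (bundledTensorIncl E F y) = inner ℂ x y :=
  UniformSpace.Completion.inner_coe x y

theorem bundledTensorMap_incl (A : E →L[ℂ] E') (B : F →L[ℂ] F') (x : E ⊗[ℂ] F) :
    bundledTensorMap A B (bundledTensorIncl E F x) =
      bundledTensorIncl E' F' (TensorProduct.mapL A B x) :=
  ContinuousLinearMap.completion_apply_coe _ _

theorem norm_bundledTensorMap_le (A : E →L[ℂ] E') (B : F →L[ℂ] F') :
    ‖bundledTensorMap A B‖ ≤ ‖A‖ * ‖B‖ :=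
  norm_hilbertTensorMap_le A B

theorem BundledTensor.clm_ext {G : Type*} [NormedAddCommGroup G] [NormedSpace ℂ G]
    {f g : BundledTensor E F →L[ℂ] G}
    (h : ∀ x : E ⊗[ℂ] F, f (bundledTensorIncl E F x) = g (bundledTensorIncl E F x)) : f = g :=
  DFunLike.coe_injective <|
    denseRange_bundledTensorIncl.equalizer f.continuous g.continuous (funext h)

theorem bundledTensorMap_add_left (A A' : E →L[ℂ] E') (B : F →L[ℂ] F') :
    bundledTensorMap (A + A') B = bundledTensorMap A B + bundledTensorMap A' B :=
  BundledTensor.clm_ext fun x => by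
    simp [bundledTensorMap_incl, TensorProduct.mapL_add_left, -TensorProduct.mapL_apply]

theorem bundledTensorMap_add_right (A : E →L[ℂ] E') (B B' : F →L[ℂ] F') :
    bundledTensorMap A (B + B') = bundledTensorMap A B + bundledTensorMap A B' :=
  BundledTensor.clm_ext fun x => by
    simp [bundledTensorMap_incl, TensorProduct.mapL_add_right, -TensorProduct.mapL_apply]

theorem bundledTensorMap_sub_left (A A' : E →L[ℂ] E') (B : F →L[ℂ] F') :
    bundledTensorMap (A - A') B = bundledTensorMap A B - bundledTensorMap A' B := by
  rw [eq_sub_iff_add_eq, ← bundledTensorMap_add_left, sub_add_cancel]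

theorem bundledTensorMap_sub_right (A : E →L[ℂ] E') (B B' : F →L[ℂ] F') :
    bundledTensorMap A (B - B') = bundledTensorMap A B - bundledTensorMap A B' := by
  rw [eq_sub_iff_add_eq, ← bundledTensorMap_add_right, sub_add_cancel]

theorem bundledTensorMap_smul_left (c : ℂ) (A : E →L[ℂ] E') (B : F →L[ℂ] F') :
    bundledTensorMap (c • A) B = c • bundledTensorMap A B :=
  BundledTensor.clm_ext fun x => by
    simp [bundledTensorMap_incl, TensorProduct.mapL_smul_left, -TensorProduct.mapL_apply]

theorem bundledTensorMap_smul_right (c : ℂ) (A : E →L[ℂ] E') (B : F →L[ℂ] F') :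
    bundledTensorMap A (c • B) = c • bundledTensorMap A B :=
  BundledTensor.clm_ext fun x => by
    simp [bundledTensorMap_incl, TensorProduct.mapL_smul_right, -TensorProduct.mapL_apply]

theorem bundledTensorMap_comp (A' : E' →L[ℂ] E'') (A : E →L[ℂ] E') (B' : F' →L[ℂ] F'')
    (B : F →L[ℂ] F') :
    bundledTensorMap (A' ∘L A) (B' ∘L B) = bundledTensorMap A' B' ∘L bundledTensorMap A B :=
  BundledTensor.clm_ext fun x => by
    simp [bundledTensorMap_incl, TensorProduct.mapL_comp, -TensorProduct.mapL_apply]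

theorem bundledTensorMap_one : bundledTensorMap (1 : E →L[ℂ] E) (1 : F →L[ℂ] F) = 1 :=
  BundledTensor.clm_ext fun x => by
    simp [bundledTensorMap_incl, ContinuousLinearMap.one_def]

theorem spectrum_bundledTensorMap_one_right_subset (A : E →L[ℂ] E) :
    spectrum ℂ (bundledTensorMap A (1 : F →L[ℂ] F)) ⊆ spectrum ℂ A := by
  let φ : (E →L[ℂ] E) →ₐ[ℂ] (BundledTensor E F →L[ℂ] BundledTensor E F) :=
    AlgHom.ofLinearMap
      { toFun A := bundledTensorMap A 1
        map_add' A A' := bundledTensorMap_add_left A A' 1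
        map_smul' c A := bundledTensorMap_smul_left c A 1 }
      bundledTensorMap_one fun A A' => by
        simpa only [ContinuousLinearMap.mul_def, ContinuousLinearMap.one_def, LinearMap.coe_mk,
          AddHom.coe_mk, ContinuousLinearMap.id_comp] using
          bundledTensorMap_comp A A' (.id ℂ F) (.id ℂ F)
  exact AlgHom.spectrum_apply_subset φ A

theorem spectrum_bundledTensorMap_one_left_subset (B : F →L[ℂ] F) :
    spectrum ℂ (bundledTensorMap (1 : E →L[ℂ] E) B) ⊆ spectrum ℂ B := by
  let φ : (F →L[ℂ] F) →ₐ[ℂ] (BundledTensor E F →L[ℂ] BundledTensor E F) :=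
    AlgHom.ofLinearMap
      { toFun B := bundledTensorMap 1 B
        map_add' B B' := bundledTensorMap_add_right 1 B B'
        map_smul' c B := bundledTensorMap_smul_right c 1 B }
      bundledTensorMap_one fun B B' => by
        simpa only [ContinuousLinearMap.mul_def, ContinuousLinearMap.one_def, LinearMap.coe_mk,
          AddHom.coe_mk, ContinuousLinearMap.id_comp] using
          bundledTensorMap_comp (.id ℂ E) (.id ℂ E) B B'
  exact AlgHom.spectrum_apply_subset φ B

theorem isCompactOperator_bundledTensorMap_of_forall_mem (A : E →L[ℂ] E') (B : F →L[ℂ] F')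
    (U : Submodule ℂ E') (V : Submodule ℂ F') [FiniteDimensional ℂ U] [FiniteDimensional ℂ V]
    (hA : ∀ x, A x ∈ U) (hB : ∀ y, B y ∈ V) : IsCompactOperator (bundledTensorMap A B) := by
  let W : Submodule ℂ (BundledTensor E' F') :=
    (LinearMap.range (TensorProduct.mapIncl U V)).map (bundledTensorIncl E' F').toLinearMap
  refine (bundledTensorMap A B).isCompactOperator_of_forall_mem W fun x => ?_
  refine denseRange_bundledTensorIncl.induction_on (p := fun x => bundledTensorMap A B x ∈ W) x
    ((Submodule.closed_of_finiteDimensional W).preimage (bundledTensorMap A B).continuous)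
    fun x => ?_
  rw [bundledTensorMap_incl]
  refine Submodule.mem_map_of_mem (f := (bundledTensorIncl E' F').toLinearMap) ?_
  induction x using TensorProduct.induction_on with
  | zero => simp
  | tmul x y => exact ⟨⟨A x, hA x⟩ ⊗ₜ ⟨B y, hB y⟩, by simp [TensorProduct.mapIncl]⟩
  | add x y hx hy => rw [map_add]; exact add_mem hx hy

theorem isCompactOperator_bundledTensorMap [CompleteSpace E'] [CompleteSpace F']
    {A : E →L[ℂ] E'} {B : F →L[ℂ] F'} (hA : IsCompactOperator A) (hB : IsCompactOperator B) :
    IsCompactOperator (bundledTensorMap A B) := by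
  refine isCompactOperator_of_forall_exists_norm_sub_lt fun ε hε => ?_
  obtain ⟨δ, hδ, hδε⟩ : ∃ δ > 0, δ * (‖A‖ + ‖B‖) < ε :=
    ⟨ε / (‖A‖ + ‖B‖ + 1), by positivity, by
      rw [div_mul_eq_mul_div, div_lt_iff₀ (by positivity)]; nlinarith⟩
  obtain ⟨U, _, hU⟩ := hA.exists_norm_sub_starProjection_comp_le hδ
  obtain ⟨V, _, hV⟩ := hB.exists_norm_sub_starProjection_comp_le hδ
  refine ⟨bundledTensorMap (U.starProjection ∘L A) (V.starProjection ∘L B),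
    isCompactOperator_bundledTensorMap_of_forall_mem _ _ U V (fun x => ?_) (fun y => ?_), ?_⟩
  · simp
  · simp
  have hPA : ‖U.starProjection ∘L A‖ ≤ ‖A‖ :=
    (ContinuousLinearMap.opNorm_comp_le _ _).trans
      (mul_le_of_le_one_left (norm_nonneg _) U.starProjection_norm_le)
  -- Replace the two factors one at a time.
  have hsplit : bundledTensorMap A B -
      bundledTensorMap (U.starProjection ∘L A) (V.starProjection ∘L B) =
      bundledTensorMap (A - U.starProjection ∘L A) B +
      bundledTensorMap (U.starProjection ∘L A) (B - V.starProjection ∘L B) := by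
    rw [bundledTensorMap_sub_left, bundledTensorMap_sub_right]; abel
  calc ‖bundledTensorMap A B -
        bundledTensorMap (U.starProjection ∘L A) (V.starProjection ∘L B)‖
      ≤ ‖A - U.starProjection ∘L A‖ * ‖B‖ +
          ‖U.starProjection ∘L A‖ * ‖B - V.starProjection ∘L B‖ := by
        rw [hsplit]
        exact (norm_add_le _ _).trans
          (add_le_add (norm_bundledTensorMap_le _ _) (norm_bundledTensorMap_le _ _))
    _ ≤ δ * ‖B‖ + ‖A‖ * δ := by gcongr
    _ < ε := by linarith

/-- A nonzero eigenvalue of a compact `A ⊗ B` is a product of spectral values of `A` and `B`. Note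
that `A ⊗ 1` and `1 ⊗ B` need not be compact; only their product is. -/
theorem exists_mem_spectrum_mul_eq_of_hasEigenvalue {A : E →L[ℂ] E} {B : F →L[ℂ] F}
    (hAB : IsCompactOperator (bundledTensorMap A B)) {z : ℂ} (hz : z ≠ 0)
    (h : End.HasEigenvalue (bundledTensorMap A B).toLinearMap z) :
    ∃ a ∈ spectrum ℂ A, ∃ b ∈ spectrum ℂ B, z = a * b := by
  set C := bundledTensorMap A B
  set L := bundledTensorMap A (1 : F →L[ℂ] F)
  set R := bundledTensorMap (1 : E →L[ℂ] E) B
  have hLR : C = L ∘L R := bundledTensorMap_comp A 1 1 B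
  have hRL : C = R ∘L L := bundledTensorMap_comp 1 A B 1
  have hfin : FiniteDimensional ℂ (End.eigenspace C.toLinearMap z) :=
    ContinuousLinearMap.finite_dimensional_eigenspace hAB z hz
  have hmaps : ∀ x ∈ End.eigenspace C.toLinearMap z,
      L.toLinearMap x ∈ End.eigenspace C.toLinearMap z := by
    intro x hx
    rw [End.mem_eigenspace_iff] at hx ⊢
    have hCL : C (L x) = L (C x) := by
      conv_lhs => rw [hLR]
      conv_rhs => rw [hRL]
      rfl
    change C x = _ at hx
    change C (L x) = z • L x
    rw [hCL, hx, map_smul]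
  have hnt : Nontrivial (End.eigenspace C.toLinearMap z) :=
    Submodule.nontrivial_iff_ne_bot.2 h
  obtain ⟨a, ha⟩ := End.exists_eigenvalue (L.toLinearMap.restrict hmaps)
  obtain ⟨⟨x, hx⟩, hax⟩ := ha.exists_hasEigenvector
  have hx0 : x ≠ 0 := fun h0 => hax.2 (Subtype.ext h0)
  have hLx : L x = a • x := congrArg Subtype.val hax.apply_eq_smul
  have hCx : C x = z • x := End.mem_eigenspace_iff.1 hx
  have hRx : a • R x = z • x := by
    rw [← hCx, ← map_smul, ← hLx, hRL]; rfl
  have ha0 : a ≠ 0 := by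
    rintro rfl
    rw [zero_smul, eq_comm, smul_eq_zero] at hRx
    exact hRx.elim hz hx0
  have hRx' : R x = (z / a) • x := by
    rw [div_eq_inv_mul, mul_smul, ← hRx, inv_smul_smul₀ ha0]
  have key : ∀ (S : BundledTensor E F →L[ℂ] BundledTensor E F) (c : ℂ), S x = c • x →
      c ∈ spectrum ℂ S := by
    intro S c hS
    rw [ContinuousLinearMap.spectrum_eq]
    exact (End.hasEigenvalue_of_hasEigenvector
      ⟨End.mem_eigenspace_iff.2 hS, hx0⟩).mem_spectrum
  exact ⟨a, spectrum_bundledTensorMap_one_right_subset A (key L a hLx), z / a,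
    spectrum_bundledTensorMap_one_left_subset B (key R _ hRx'), by field_simp⟩

end HilbertTensor

/-! ### Hilbert sums of operators -/

section DirectSum

variable {E : ℕ → Type*} [∀ n, NormedAddCommGroup (E n)] [∀ n, NormedSpace ℂ (E n)]
  {A : ∀ n, E n →L[ℂ] E n} {K : ℝ} {hK : 0 ≤ K} {hAK : ∀ n, ‖A n‖ ≤ K}

/-- A Hilbert sum of compact operators whose norms tend to `0` is compact. -/
theorem lp.isCompactOperator_mapCLM [∀ n, CompleteSpace (E n)] (hA : ∀ n, IsCompactOperator (A n))
    (hlim : Tendsto (fun n => ‖A n‖) atTop (𝓝 0)) : IsCompactOperator (lp.mapCLM 2 A hK hAK) := by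
  refine isCompactOperator_of_forall_exists_norm_sub_lt fun ε hε => ?_
  obtain ⟨N, hN⟩ := eventually_atTop.1 (hlim.eventually_le_const (half_pos hε))
  -- `A'` is the tail of the family, and `B` the sum of its first `N` members.
  let A' : ∀ n, E n →L[ℂ] E n := fun n => if n < N then 0 else A n
  have hA' : ∀ n, ‖A' n‖ ≤ ε / 2 := by
    intro n
    by_cases hn : n < N
    · simpa [A', hn] using (half_pos hε).le
    · simpa [A', hn] using hN n (not_lt.1 hn)
  let B : lp E 2 →L[ℂ] lp E 2 := ∑ n ∈ Finset.range N,
    lp.singleContinuousLinearMap ℂ E 2 n ∘L A n ∘L lp.evalCLM ℂ E 2 n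
  have hB : B ∈ compactOperator (RingHom.id ℂ) (lp E 2) (lp E 2) :=
    Submodule.sum_mem _ fun n _ =>
      ((hA n).comp_clm (lp.evalCLM ℂ E 2 n)).clm_comp (lp.singleContinuousLinearMap ℂ E 2 n)
  have hsub : lp.mapCLM 2 A hK hAK - B = lp.mapCLM 2 A' (half_pos hε).le hA' := by
    ext x m
    have hBm : (B x) m = if m < N then A m (x m) else 0 := by
      simp only [B, _root_.sum_apply, lp.coeFn_sum, Finset.sum_apply,
        ContinuousLinearMap.comp_apply, lp.singleContinuousLinearMap_apply, lp.coeFn_single]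
      rw [Finset.sum_pi_single]
      simp only [Finset.mem_range]
      rfl
    change A m (x m) - (B x) m = A' m (x m)
    rw [hBm]
    by_cases hm : m < N <;> simp [A', hm]
  refine ⟨B, hB, ?_⟩
  rw [hsub]
  exact (lp.norm_mapCLM_le 2 A' _ hA').trans_lt (half_lt_self hε)

theorem lp.hasEigenvalue_mapCLM_iff {z : ℂ} :
    End.HasEigenvalue (lp.mapCLM 2 A hK hAK).toLinearMap z ↔
      ∃ n, End.HasEigenvalue (A n).toLinearMap z := by
  constructor
  · intro h
    obtain ⟨x, hx⟩ := h.exists_hasEigenvector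
    obtain ⟨n, hn⟩ : ∃ n, x n ≠ 0 := by
      by_contra! h0
      exact hx.2 (lp.ext (funext h0))
    refine ⟨n, End.hasEigenvalue_of_hasEigenvector ⟨End.mem_eigenspace_iff.2 ?_, hn⟩⟩
    exact congrArg (fun y : lp E 2 => y n) hx.apply_eq_smul
  · rintro ⟨n, h⟩
    obtain ⟨x, hx⟩ := h.exists_hasEigenvector
    refine End.hasEigenvalue_of_hasEigenvector (x := lp.single 2 n x)
      ⟨End.mem_eigenspace_iff.2 ?_, fun h0 => hx.2 ?_⟩
    · have hAx : A n x = z • x := hx.apply_eq_smul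
      ext m
      change A m (lp.single 2 n x m) = z • lp.single 2 n x m
      obtain rfl | hm := eq_or_ne m n
      · simpa using hAx
      · rw [lp.single_apply_ne 2 n x hm, map_zero, smul_zero]
    · simpa using congrArg (fun y : lp E 2 => y n) h0

theorem lp.mem_spectrum_mapCLM_iff [∀ n, CompleteSpace (E n)]
    (hA : ∀ n, IsCompactOperator (A n)) (hlim : Tendsto (fun n => ‖A n‖) atTop (𝓝 0))
    {z : ℂ} (hz : z ≠ 0) :
    z ∈ spectrum ℂ (lp.mapCLM 2 A hK hAK) ↔ ∃ n, End.HasEigenvalue (A n).toLinearMap z := by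
  rw [← (lp.isCompactOperator_mapCLM hA hlim).hasEigenvalue_iff_mem_spectrum hz,
    lp.hasEigenvalue_mapCLM_iff]

/-- If the norms of the summands tend to `0`, then their Hilbert sum is not bounded below. -/
theorem lp.zero_mem_spectrum_mapCLM [∀ n, Nontrivial (E n)]
    (hlim : Tendsto (fun n => ‖A n‖) atTop (𝓝 0)) :
    (0 : ℂ) ∈ spectrum ℂ (lp.mapCLM 2 A hK hAK) := by
  rw [spectrum.zero_mem_iff]
  intro hu
  obtain ⟨R, hR⟩ := hu.exists_left_inv
  have hbound : ∀ n, 1 ≤ ‖R‖ * ‖A n‖ := by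
    intro n
    obtain ⟨x, hx⟩ := exists_ne (0 : E n)
    have hsingle : lp.mapCLM 2 A hK hAK (lp.single 2 n x) = lp.single 2 n (A n x) := by
      ext m
      change A m (lp.single 2 n x m) = _
      obtain rfl | hm := eq_or_ne m n
      · simp
      · rw [lp.single_apply_ne 2 n _ hm, lp.single_apply_ne 2 n _ hm, map_zero]
    have hxn : ‖x‖ ≤ ‖R‖ * ‖A n‖ * ‖x‖ := calc
      ‖x‖ = ‖R (lp.mapCLM 2 A hK hAK (lp.single 2 n x))‖ := by
        rw [← mul_apply_eq_comp, hR, one_apply_eq_self,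
          lp.norm_single (by norm_num)]
      _ ≤ ‖R‖ * ‖A n x‖ := by
        rw [hsingle]
        exact (R.le_opNorm _).trans_eq (by rw [lp.norm_single (by norm_num)])
      _ ≤ ‖R‖ * ‖A n‖ * ‖x‖ := by
        rw [mul_assoc]; gcongr; exact (A n).le_opNorm x
    exact le_of_mul_le_mul_right (by rwa [one_mul]) (norm_pos_iff.2 hx)
  have h0 : Tendsto (fun n => ‖R‖ * ‖A n‖) atTop (𝓝 0) := by simpa using hlim.const_mul ‖R‖
  exact absurd (ge_of_tendsto' h0 hbound) (by norm_num)

end DirectSum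

/-! ### Tensor powers and symmetric tensor powers -/

section TensorPower

variable {H : Type u} [NormedAddCommGroup H] [InnerProductSpace ℂ H]

theorem elementaryTensor_succ (n : ℕ) (h : Fin (n + 1) → H) :
    elementaryTensor (n + 1) h = bundledTensorIncl (HilbertTensorPower H n) H
      (elementaryTensor n (fun i => h i.castSucc) ⊗ₜ h (Fin.last n)) :=
  rfl

theorem inner_elementaryTensor (n : ℕ) (h k : Fin n → H) :
    inner ℂ (elementaryTensor n h) (elementaryTensor n k) = ∏ i, inner ℂ (h i) (k i) := by
  induction n with
  | zero =>
    change inner ℂ (1 : ℂ) (1 : ℂ) = _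
    simp
  | succ n ih =>
    rw [elementaryTensor_succ, elementaryTensor_succ, Fin.prod_univ_castSucc, ← ih]
    exact (inner_bundledTensorIncl _ _).trans (TensorProduct.inner_tmul ..)

theorem elementaryTensor_smul (n : ℕ) (c : Fin n → ℂ) (h : Fin n → H) :
    elementaryTensor n (fun i => c i • h i) = (∏ i, c i) • elementaryTensor n h := by
  induction n with
  | zero => simp [Subsingleton.elim (fun i : Fin 0 => c i • h i) h]
  | succ n ih =>
    rw [elementaryTensor_succ, elementaryTensor_succ, Fin.prod_univ_castSucc, ih,
      TensorProduct.smul_tmul_smul]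
    exact map_smul (bundledTensorIncl (HilbertTensorPower H n) H) _ _

theorem norm_tensorPowerMap_le_pow (T : H →L[ℂ] H) (n : ℕ) : ‖tensorPowerMap T n‖ ≤ ‖T‖ ^ n := by
  induction n with
  | zero =>
    rw [pow_zero]
    exact ContinuousLinearMap.norm_id_le (𝕜 := ℂ) (E := ULift.{u} ℂ)
  | succ n ih =>
    rw [pow_succ]
    exact (norm_bundledTensorMap_le (tensorPowerMap T n) T).trans (by gcongr)

theorem isCompactOperator_tensorPowerMap [CompleteSpace H] {T : H →L[ℂ] H}
    (hT : IsCompactOperator T) (n : ℕ) : IsCompactOperator (tensorPowerMap T n) := by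
  induction n with
  | zero =>
    have : FiniteDimensional ℂ (ULift.{u} ℂ) := inferInstance
    have : ProperSpace (ULift.{u} ℂ) := FiniteDimensional.proper ℂ _
    exact isCompactOperator_of_locallyCompactSpace_rng (ContinuousLinearMap.id ℂ (ULift.{u} ℂ))
  | succ n ih => exact isCompactOperator_bundledTensorMap ih hT

theorem exists_prod_eq_of_hasEigenvalue_tensorPowerMap [CompleteSpace H] {T : H →L[ℂ] H}
    (hT : IsCompactOperator T) {n : ℕ} {z : ℂ} (hz : z ≠ 0)
    (h : End.HasEigenvalue (tensorPowerMap T n).toLinearMap z) :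
    ∃ l : Fin n → ℂ, (∀ j, l j ∈ spectrum ℂ T) ∧ z = ∏ j, l j := by
  induction n generalizing z with
  | zero =>
    obtain ⟨x, hx⟩ := h.exists_hasEigenvector
    have hx1 : x = z • x := hx.apply_eq_smul
    refine ⟨Fin.elim0, fun j => j.elim0, ?_⟩
    have h0 : (z - 1) • x = 0 := by rw [sub_smul, one_smul, ← hx1, sub_self]
    simpa [sub_eq_zero] using (smul_eq_zero.1 h0).resolve_right hx.2
  | succ n ih =>
    obtain ⟨a, ha, b, hb, rfl⟩ := exists_mem_spectrum_mul_eq_of_hasEigenvalue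
      (isCompactOperator_bundledTensorMap (isCompactOperator_tensorPowerMap hT n) hT) hz h
    have ha0 : a ≠ 0 := left_ne_zero_of_mul hz
    obtain ⟨l, hl, rfl⟩ := ih ha0
      (((isCompactOperator_tensorPowerMap hT n).hasEigenvalue_iff_mem_spectrum ha0).2 ha)
    refine ⟨Fin.snoc l b, fun j => ?_, by simp [Fin.prod_univ_castSucc]⟩
    induction j using Fin.lastCases with
    | last => simpa using hb
    | cast j => simpa using hl j

/-- The symmetrized product of nonzero vectors is nonzero: pair it with the power `v ⊗ ⋯ ⊗ v` of a
vector `v` that is orthogonal to none of them. -/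
theorem symmetricTensor_ne_zero {n : ℕ} {h : Fin n → H} (hh : ∀ j, h j ≠ 0) :
    symmetricTensor n h ≠ 0 := by
  obtain ⟨v, hv⟩ := Module.Dual.exists_forall_ne_zero_of_forall_exists
    (fun j => (innerₛₗ ℂ (h j) : Dual ℂ H)) fun j => ⟨h j, by simpa using hh j⟩
  have hv' : ∀ j, inner ℂ v (h j) ≠ 0 := fun j h0 => hv j (inner_eq_zero_symm.1 h0)
  intro h0
  have hinner : inner ℂ (elementaryTensor n fun _ => v) (symmetricTensor n h) =
      (Nat.factorial n : ℂ) * ∏ j, inner ℂ v (h j) := by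
    simp only [symmetricTensor, inner_sum, inner_elementaryTensor]
    rw [Finset.sum_congr rfl fun σ _ => Equiv.prod_comp σ fun j => inner ℂ v (h j)]
    simp [Fintype.card_perm]
  rw [h0, inner_zero_right] at hinner
  exact mul_ne_zero (Nat.cast_ne_zero.2 n.factorial_ne_zero)
    (Finset.prod_ne_zero_iff.2 fun j _ => hv' j) hinner.symm

theorem tensorPowerMap_symmetricTensor (T : H →L[ℂ] H) {n : ℕ} {h : Fin n → H} {l : Fin n → ℂ}
    (hl : ∀ j, T (h j) = l j • h j) :
    tensorPowerMap T n (symmetricTensor n h) = (∏ j, l j) • symmetricTensor n h := by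
  simp only [symmetricTensor, map_sum, tensorPowerMap_elementaryTensor, hl, Finset.smul_sum]
  refine Finset.sum_congr rfl fun σ _ => ?_
  rw [elementaryTensor_smul, Equiv.prod_comp σ l]

theorem symmetricTensor_mem_symmetricPower (n : ℕ) (h : Fin n → H) :
    symmetricTensor n h ∈ symmetricPower H n :=
  Submodule.le_topologicalClosure _ (Submodule.subset_span ⟨h, rfl⟩)

instance completeSpace_symmetricPower (n : ℕ) : CompleteSpace (symmetricPower H n) :=
  (Submodule.isClosed_topologicalClosure _).completeSpace_coe

instance nontrivial_symmetricPower [Nontrivial H] (n : ℕ) : Nontrivial (symmetricPower H n) := by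
  obtain ⟨x, hx⟩ := exists_ne (0 : H)
  exact ⟨⟨_, symmetricTensor_mem_symmetricPower n fun _ => x⟩, 0, fun h =>
    symmetricTensor_ne_zero (fun _ => hx) (congrArg Subtype.val h)⟩

instance nontrivial_tensorPower [Nontrivial H] (n : ℕ) : Nontrivial (HilbertTensorPower H n) :=
  (Subtype.val_injective (p := (· ∈ symmetricPower H n))).nontrivial

theorem norm_symmetricPowerMap_le_pow (T : H →L[ℂ] H) (n : ℕ) :
    ‖symmetricPowerMap T n‖ ≤ ‖T‖ ^ n :=
  ContinuousLinearMap.opNorm_le_bound _ (by positivity) fun x =>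
    (tensorPowerMap T n).le_of_opNorm_le (norm_tensorPowerMap_le_pow T n) x

theorem isCompactOperator_symmetricPowerMap [CompleteSpace H] {T : H →L[ℂ] H}
    (hT : IsCompactOperator T) (n : ℕ) : IsCompactOperator (symmetricPowerMap T n) :=
  IsCompactOperator.restrict (f := (tensorPowerMap T n).toLinearMap)
    (isCompactOperator_tensorPowerMap hT n) (tensorPowerMap_mem_symmetricPower T n)
    (Submodule.isClosed_topologicalClosure _)

theorem hasEigenvalue_tensorPowerMap_of_symmetricPowerMap {T : H →L[ℂ] H} {n : ℕ} {z : ℂ}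
    (h : End.HasEigenvalue (symmetricPowerMap T n).toLinearMap z) :
    End.HasEigenvalue (tensorPowerMap T n).toLinearMap z := by
  obtain ⟨x, hx⟩ := h.exists_hasEigenvector
  exact End.hasEigenvalue_of_hasEigenvector (x := (x : HilbertTensorPower H n))
    ⟨End.mem_eigenspace_iff.2 (congrArg Subtype.val hx.apply_eq_smul),
      fun h0 => hx.2 (Subtype.ext h0)⟩

/-- The symmetric tensor of eigenvectors of `T` is an eigenvector of `T^{⊙n}`. -/
theorem hasEigenvalue_symmetricPowerMap_prod [CompleteSpace H] {T : H →L[ℂ] H}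
    (hT : IsCompactOperator T) {n : ℕ} {l : Fin n → ℂ} (hl : ∀ j, l j ∈ spectrum ℂ T)
    (hl0 : ∀ j, l j ≠ 0) :
    End.HasEigenvalue (symmetricPowerMap T n).toLinearMap (∏ j, l j) := by
  choose h hh using fun j =>
    ((hT.hasEigenvalue_iff_mem_spectrum (hl0 j)).2 (hl j)).exists_hasEigenvector
  refine End.hasEigenvalue_of_hasEigenvector
    (x := ⟨_, symmetricTensor_mem_symmetricPower n h⟩)
    ⟨End.mem_eigenspace_iff.2 (Subtype.ext ?_), fun h0 => ?_⟩
  · exact tensorPowerMap_symmetricTensor T fun j => (hh j).apply_eq_smul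
  · exact symmetricTensor_ne_zero (fun j => (hh j).2) (congrArg Subtype.val h0)

end TensorPower
end

/-! ### The spectrum of the second quantizations -/

theorem corollary3p5 {H : Type u} [NormedAddCommGroup H] [InnerProductSpace ℂ H] [CompleteSpace H]
    [Nontrivial H] (T : H →L[ℂ] H) (hcompact : IsCompactOperator T) (hT : ‖T‖ < 1) :
    spectrum ℂ (symmetricSecondQuantization T hT.le) = spectrum ℂ (secondQuantization T hT.le) ∧
      spectrum ℂ (secondQuantization T hT.le) =
        {0} ∪ {1} ∪ ⋃ n ≥ 1, {z : ℂ | ∃ l : Fin n → ℂ, (∀ j, l j ∈ spectrum ℂ T) ∧ z = ∏ j, l j} := by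
  have hpow := tendsto_pow_atTop_nhds_zero_of_lt_one (norm_nonneg T) hT
  have hlim : Filter.Tendsto (fun n => ‖tensorPowerMap T n‖) Filter.atTop (nhds 0) :=
    squeeze_zero (fun n => norm_nonneg (tensorPowerMap T n)) (norm_tensorPowerMap_le_pow T) hpow
  have hlim' : Filter.Tendsto (fun n => ‖symmetricPowerMap T n‖) Filter.atTop (nhds 0) :=
    squeeze_zero (fun n => norm_nonneg (symmetricPowerMap T n))
      (norm_symmetricPowerMap_le_pow T) hpow
  set S : Set ℂ := {0} ∪ {1} ∪
    ⋃ n ≥ 1, {z : ℂ | ∃ l : Fin n → ℂ, (∀ j, l j ∈ spectrum ℂ T) ∧ z = ∏ j, l j}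
  -- Away from `0`, the set `S` consists of all products, the empty product being `1`.
  have hS : ∀ z : ℂ, z ≠ 0 →
      (z ∈ S ↔ ∃ n, ∃ l : Fin n → ℂ, (∀ j, l j ∈ spectrum ℂ T) ∧ z = ∏ j, l j) := by
    intro z hz
    simp only [S, Set.mem_union, Set.mem_singleton_iff, hz, false_or, Set.mem_iUnion,
      Set.mem_ofPred_eq]
    constructor
    · rintro (rfl | ⟨n, -, h⟩)
      · exact ⟨0, Fin.elim0, fun j => j.elim0, by simp⟩
      · exact ⟨n, h⟩
    · rintro ⟨n, l, hl, h⟩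
      obtain rfl | hn := Nat.eq_zero_or_pos n
      · exact Or.inl (by simpa using h)
      · exact Or.inr ⟨n, hn, l, hl, h⟩
  have htens : spectrum ℂ (secondQuantization T hT.le) = S := by
    ext z
    obtain rfl | hz := eq_or_ne z 0
    · exact iff_of_true (lp.zero_mem_spectrum_mapCLM hlim) (Or.inl (Or.inl rfl))
    rw [hS z hz, secondQuantization,
      lp.mem_spectrum_mapCLM_iff (isCompactOperator_tensorPowerMap hcompact) hlim hz]
    refine exists_congr fun n => ⟨exists_prod_eq_of_hasEigenvalue_tensorPowerMap hcompact hz, ?_⟩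
    rintro ⟨l, hl, rfl⟩
    exact hasEigenvalue_tensorPowerMap_of_symmetricPowerMap <|
      hasEigenvalue_symmetricPowerMap_prod hcompact hl fun j =>
        Finset.prod_ne_zero_iff.1 hz j (Finset.mem_univ j)
  refine ⟨?_, htens⟩
  rw [htens]
  ext z
  obtain rfl | hz := eq_or_ne z 0
  · exact iff_of_true (lp.zero_mem_spectrum_mapCLM hlim') (Or.inl (Or.inl rfl))
  rw [hS z hz, symmetricSecondQuantization,
    lp.mem_spectrum_mapCLM_iff (isCompactOperator_symmetricPowerMap hcompact) hlim' hz]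
  refine exists_congr fun n => ⟨fun h => exists_prod_eq_of_hasEigenvalue_tensorPowerMap hcompact hz
    (hasEigenvalue_tensorPowerMap_of_symmetricPowerMap h), ?_⟩
  rintro ⟨l, hl, rfl⟩
  exact hasEigenvalue_symmetricPowerMap_prod hcompact hl fun j =>
    Finset.prod_ne_zero_iff.1 hz j (Finset.mem_univ j)
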